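/- A source broadcasts blocks of $k$ packets to users over erasure channels in slots $t=1,2,\dots$. Let $C_i[t]\in\{0,1\}$ be the state of user $i$'s channel in slot $t$ ($1$ = the coded packet sent in that slot is received, $0$ = erasure). For a sequence $(p_i)_{i\ge1}$ in $[0,1]$, the (asymmetric, time-invariant) system with erasure probabilities $(p_i)$ has all $C_i[t]$ independent over users and slots with $P(C_i[t]=0)=p_i$. In the system with the users $1,\dots,n$ and block size $k$, the source sends coded packets of the current block until every one of the $n$ users has received $k$ of them, and then starts the next block. The decoding delay $U^{(j)}=\max_{i\le n}Y^{(j)}_i\in\mathbb N\cup\{\infty\}$ of block $j$ is the number of slots spent on it, where $Y^{(j)}_i$ is the number of slots, counted from the start of the block, until user $i$ has received $k$ coded packets. Let $R[t]$ be $k$ times the number of blocks completed by slot $t$; the throughput $\eta(n,k)$ is the almost sure limit of $R[t]/t$ as $t\to\infty$. Let $p_0=\sup_i p_i$. Write $U_1^{(j)},\eta_1$ for the delays and the throughput of the asymmetric system with erasure probabilities $(p_i)$, and $U_0^{(j)},\eta_0$ for those of the symmetric system in which every erasure probability is $p_0$. Then: 1. For all $n,k,j,t$: $P(U_0^{(j)}\le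 t)\le P(U_1^{(j)}\le t)$, and $\mathbb E[U_1^{(j)}]\le\mathbb E[U_0^{(j)}]$ (expectations in $[0,\infty]$). 2. For all $n,k\ge1$ the throughputs $\eta_1(n,k)$ and $\eta_0(n,k)$ exist (as deterministic constants), and $\eta_0(n,k)\le\eta_1(n,k)\le 1-\max_{i\le n}p_i$. 3. For every $n\ge1$, the capacity of the asymmetric system with $n$ users, i.e. the supremum $\sup_{k\ge1}\eta_1(n,k)$ of its throughput over all block sizes, equals $1-\max_{i\le n}p_i$; and $\inf_{n\ge1}\bigl(1-\max_{i\le n}p_i\bigr)=1-p_0$. 4. If $k=k(n)$ is a sequence of natural numbers with $k(n)/\ln n\to\infty$ as $n\to\infty$ (that is, $k=\omega(\ln n)$), then $$\lim_{n\to\infty}\eta_0(n,k(n))=\lim_{n\to\infty}\eta_1(n,k(n))=1-p_0 .$$ -/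

import Mathlib

open MeasureTheory ProbabilityTheory Filter Topology
open scoped ENNReal

namespace RLNC

/-- Independent time-invariant erasure channels. `C i t ω` is the state of user `i`'s channel in slot
`t` (`true` = on = `1`, `false` = off = erasure = `0`). The states are independent over all users and
all slots, and user `i`'s channel is off in any given slot with probability `p i`. -/
structure IsErasureSystem {Ω : Type*} [MeasurableSpace Ω] (P : Measure Ω)
    (p : ℕ → ℝ) (C : ℕ → ℕ → Ω → Bool) : Prop where
  measurable : ∀ i t, Measurable (C i t)
  indep : iIndepFun (fun x : ℕ × ℕ => C x.1 x.2) P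
  law : ∀ i t, P {ω | C i t ω = false} = ENNReal.ofReal (p i)

/-- Number of coded packets that user `i` receives in the slots `s + 1, …, s + u`. -/
def received {Ω : Type*} (C : ℕ → ℕ → Ω → Bool) (i s u : ℕ) (ω : Ω) : ℕ :=
  ((Finset.Ioc s (s + u)).filter (fun τ => C i τ ω = true)).card

/-- Number of slots, counted from the end of slot `s`, until user `i` has received `k` coded packets.
It is `⊤` if this never happens, and if the transmission never starts (`s = ⊤`). -/
noncomputable def userDelayFrom {Ω : Type*} (C : ℕ → ℕ → Ω → Bool) (k i : ℕ) (s : ℕ∞) (ω : Ω) : ℕ∞ :=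
  ⨅ (m : ℕ) (u : ℕ) (_ : s = (m : ℕ∞) ∧ k ≤ received C i m u ω), (u : ℕ∞)

/-- The maximum over the users `0, …, n - 1` of the delays counted from the end of slot `s`. -/
noncomputable def delayFrom {Ω : Type*} (C : ℕ → ℕ → Ω → Bool) (n k : ℕ) (s : ℕ∞) (ω : Ω) : ℕ∞ :=
  ⨆ i : Fin n, userDelayFrom C k i s ω

/-- The slot in which the first `j` blocks of `k` packets have been completed: the next block starts
as soon as all `n` users have received `k` coded packets of the current one. -/
noncomputable def completionTime {Ω : Type*} (C : ℕ → ℕ → Ω → Bool) (n k : ℕ) (ω : Ω) : ℕ → ℕ∞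
  | 0 => 0
  | j + 1 => completionTime C n k ω j + delayFrom C n k (completionTime C n k ω j) ω

/-- Decoding delay of block `j` (blocks are numbered `0, 1, 2, …`). -/
noncomputable def decodingDelay {Ω : Type*} (C : ℕ → ℕ → Ω → Bool) (n k j : ℕ) (ω : Ω) : ℕ∞ :=
  delayFrom C n k (completionTime C n k ω j) ω

/-- Mean decoding delay of block `j`, in `[0, ∞]`. -/
noncomputable def meanDelay {Ω : Type*} [MeasurableSpace Ω] (P : Measure Ω)
    (C : ℕ → ℕ → Ω → Bool) (n k j : ℕ) : ℝ≥0∞ :=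
  ∫⁻ ω, ((decodingDelay C n k j ω : ℕ∞) : ℝ≥0∞) ∂P

/-- Number of data packets transferred to all `n` users in the slots `1, …, t`: `k` for each completed
block. (For `n, k ≥ 1` at most `t` blocks are completed by slot `t`, so the set is finite.) -/
noncomputable def packets {Ω : Type*} (C : ℕ → ℕ → Ω → Bool) (n k t : ℕ) (ω : Ω) : ℕ :=
  k * {j : ℕ | completionTime C n k ω (j + 1) ≤ (t : ℕ∞)}.ncard

/-- `η` is the broadcast throughput: almost surely, the long-term average number of packets
transferred to all users per slot converges to `η`. -/
def IsThroughput {Ω : Type*} [MeasurableSpace Ω] (P : Measure Ω)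
    (C : ℕ → ℕ → Ω → Bool) (n k : ℕ) (η : ℝ) : Prop :=
  ∀ᵐ ω ∂P, Tendsto (fun t : ℕ => (packets C n k t ω : ℝ) / (t : ℝ)) atTop (𝓝 η)

end RLNC

/-! Everything reduces to one distribution function. The number of packets a user receives in `u`
slots is binomial, and the users are independent, so a block started at a fixed slot is finished
within `u` slots with probability `delayCDF p n k u`, a product of binomial tails. The start of
block `j` is random, but the event that it equals `m` depends only on slots up to `m`. Conditionally
on starting, the block therefore behaves like the first one (`measure_inter_delay`), and with `F =
delayCDF p n k` this gives `P(U ≤ t) = (sup F) ^ j * F t`. Both factors decrease when erasure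
probabilities grow, which yields the comparison; the means follow by summing tails.

If the mean delay is finite, the delays are identically distributed and pairwise independent. The
strong law and a pathwise renewal argument then give the throughput `k / E[U]`. If it is infinite,
some user never receives anything and the throughput is `0`.

It remains to estimate `E[U] = ∑ (1 - F t)`. It is at least the negative binomial mean `k / (1 - p
i)` of each user. Conversely, a union bound and Chernoff's bound give `E[U] ≤ a k + 1 + B n exp (-δ
k)` for each `a > 1 / (1 - q)`, where `q < 1` bounds the erasure probabilities
(`exists_meanDelayOf_le`). The error is negligible against `k` both for fixed `n` with `k → ∞` and
for `k = ω(ln n)`. -/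

namespace RLNC

/-! ### Binomial tails for a single channel -/

/-- The probability that at least `k` out of `t` independent packets are received, when each of them
is erased with probability `p`. -/
noncomputable def tailProb (p : ℝ) : ℕ → ℕ → ℝ
  | 0, 0 => 1
  | 0, _ + 1 => 0
  | _ + 1, 0 => 1
  | t + 1, k + 1 => p * tailProb p t (k + 1) + (1 - p) * tailProb p t k

@[simp] lemma tailProb_zero_right (p : ℝ) (t : ℕ) : tailProb p t 0 = 1 := by
  cases t <;> rfl

@[simp] lemma tailProb_zero_succ (p : ℝ) (k : ℕ) : tailProb p 0 (k + 1) = 0 := rfl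

lemma tailProb_succ_succ (p : ℝ) (t k : ℕ) :
    tailProb p (t + 1) (k + 1) = p * tailProb p t (k + 1) + (1 - p) * tailProb p t k := rfl

lemma tailProb_mem_Icc {p : ℝ} (hp : p ∈ Set.Icc (0 : ℝ) 1) (t k : ℕ) :
    tailProb p t k ∈ Set.Icc (0 : ℝ) 1 := by
  obtain ⟨h0, h1⟩ := hp
  induction t generalizing k with
  | zero => cases k <;> simp
  | succ t ih =>
    cases k with
    | zero => simp
    | succ k =>
      obtain ⟨a0, a1⟩ := ih (k + 1)
      obtain ⟨b0, b1⟩ := ih k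
      rw [tailProb_succ_succ]
      constructor
      · have : 0 ≤ 1 - p := by linarith
        positivity
      · nlinarith

lemma tailProb_succ_right_le {p : ℝ} (hp : p ∈ Set.Icc (0 : ℝ) 1) (t k : ℕ) :
    tailProb p t (k + 1) ≤ tailProb p t k := by
  obtain ⟨h0, h1⟩ := id hp
  induction t generalizing k with
  | zero => cases k <;> simp
  | succ t ih =>
    cases k with
    | zero => simpa using (tailProb_mem_Icc hp _ _).2
    | succ k =>
      rw [tailProb_succ_succ, tailProb_succ_succ]
      have := ih (k + 1)
      have := ih k
      have : 0 ≤ 1 - p := by linarith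
      gcongr

lemma tailProb_monotone_left {p : ℝ} (hp : p ∈ Set.Icc (0 : ℝ) 1) (k : ℕ) :
    Monotone fun t => tailProb p t k := by
  refine monotone_nat_of_le_succ fun t => ?_
  cases k with
  | zero => simp
  | succ k =>
    rw [tailProb_succ_succ]
    nlinarith [tailProb_succ_right_le hp t k, hp.1, hp.2]

/-- One step of the recursion averages a smaller value (weight `p` on `k + 1`) and a larger one
(weight `1 - p` on `k`), so a larger `p` lowers the average. This takes the place of a coupling. -/
lemma tailProb_anti {p q : ℝ} (hp : p ∈ Set.Icc (0 : ℝ) 1) (hq : q ∈ Set.Icc (0 : ℝ) 1)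
    (hpq : p ≤ q) (t k : ℕ) : tailProb q t k ≤ tailProb p t k := by
  induction t generalizing k with
  | zero => cases k <;> simp
  | succ t ih =>
    cases k with
    | zero => simp
    | succ k =>
      rw [tailProb_succ_succ, tailProb_succ_succ]
      nlinarith [ih k, ih (k + 1), tailProb_succ_right_le hp t k, hp.1, hp.2, hq.1, hq.2]

lemma tailProb_one_succ (t k : ℕ) : tailProb 1 t (k + 1) = 0 := by
  induction t with
  | zero => simp
  | succ t ih => rw [tailProb_succ_succ, ih]; simp

/-- Chernoff's bound for the lower tail of a binomial distribution. -/
lemma one_sub_tailProb_le {p θ : ℝ} (hp : p ∈ Set.Icc (0 : ℝ) 1) (hθ : 0 ≤ θ) (t k : ℕ) :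
    1 - tailProb p t k ≤ Real.exp (θ * k) * (p + (1 - p) * Real.exp (-θ)) ^ t := by
  have h1p : 0 ≤ 1 - p := by linarith [hp.2]
  have hr : 0 ≤ p + (1 - p) * Real.exp (-θ) := add_nonneg hp.1 (by positivity)
  induction t generalizing k with
  | zero =>
    have : (1 : ℝ) ≤ Real.exp (θ * k) := Real.one_le_exp (by positivity)
    have := (tailProb_mem_Icc hp 0 k).1
    simp only [pow_zero, mul_one]
    linarith
  | succ t ih =>
    cases k with
    | zero => simp only [tailProb_zero_right, sub_self]; positivity
    | succ k =>
      -- The bound satisfies the recursion of `1 - tailProb` with equality, since lowering `k` by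
      -- one multiplies it by `exp (-θ)`; no exponential moments are needed.
      have e : Real.exp (θ * k) = Real.exp (θ * (k + 1 : ℕ)) * Real.exp (-θ) := by
        rw [← Real.exp_add]; push_cast; ring_nf
      calc 1 - tailProb p (t + 1) (k + 1)
          = p * (1 - tailProb p t (k + 1)) + (1 - p) * (1 - tailProb p t k) := by
            rw [tailProb_succ_succ]; ring
        _ ≤ p * (Real.exp (θ * (k + 1 : ℕ)) * (p + (1 - p) * Real.exp (-θ)) ^ t) +
            (1 - p) * (Real.exp (θ * k) * (p + (1 - p) * Real.exp (-θ)) ^ t) :=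
            add_le_add (mul_le_mul_of_nonneg_left (ih _) hp.1)
              (mul_le_mul_of_nonneg_left (ih _) h1p)
        _ = _ := by rw [e]; ring

/-- The mean of a negative binomial distribution. -/
lemma mul_tsum_one_sub_tailProb {p : ℝ} (hp : p ∈ Set.Icc (0 : ℝ) 1) (k : ℕ)
    (hs : Summable fun t => 1 - tailProb p t k) :
    (1 - p) * ∑' t, (1 - tailProb p t k) = k := by
  induction k with
  | zero => simp
  | succ k ih =>
    have hs' : Summable fun t => 1 - tailProb p t k :=
      hs.of_nonneg_of_le (fun t => by linarith [(tailProb_mem_Icc hp t k).2])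
        (fun t => by linarith [tailProb_succ_right_le hp t k])
    -- Summing the recursion over `t` gives `S (k+1) = 1 + p * S (k+1) + (1 - p) * S k`, where the
    -- `1` is the term `t = 0`.
    have h := hs.tsum_eq_zero_add
    have e : ∀ t, 1 - tailProb p (t + 1) (k + 1) =
        p * (1 - tailProb p t (k + 1)) + (1 - p) * (1 - tailProb p t k) := fun t => by
      rw [tailProb_succ_succ]; ring
    simp_rw [e] at h
    rw [(hs.mul_left p).tsum_add (hs'.mul_left (1 - p)), tsum_mul_left, tsum_mul_left, ih hs'] at h
    simp only [tailProb_zero_succ, sub_zero] at h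
    push_cast
    linarith

/-! ### The delay distribution of a block -/

/-- The distribution function of the delay of a block of `k` packets, for the users
`0, …, n - 1`. -/
noncomputable def delayCDF (p : ℕ → ℝ) (n k t : ℕ) : ℝ :=
  ∏ i ∈ Finset.range n, tailProb (p i) t k


lemma delayCDF_mem_Icc {p : ℕ → ℝ} (hp : ∀ i, p i ∈ Set.Icc (0 : ℝ) 1) (n k t : ℕ) :
    delayCDF p n k t ∈ Set.Icc (0 : ℝ) 1 :=
  ⟨Finset.prod_nonneg fun i _ => (tailProb_mem_Icc (hp i) t k).1,
    Finset.prod_le_one (fun i _ => (tailProb_mem_Icc (hp i) t k).1)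
      fun i _ => (tailProb_mem_Icc (hp i) t k).2⟩

lemma delayCDF_monotone {p : ℕ → ℝ} (hp : ∀ i, p i ∈ Set.Icc (0 : ℝ) 1) (n k : ℕ) :
    Monotone (delayCDF p n k) := fun _ _ h =>
  Finset.prod_le_prod (fun i _ => (tailProb_mem_Icc (hp i) _ k).1)
    fun i _ => tailProb_monotone_left (hp i) k h

lemma delayCDF_anti {p q : ℕ → ℝ} (hp : ∀ i, p i ∈ Set.Icc (0 : ℝ) 1)
    (hq : ∀ i, q i ∈ Set.Icc (0 : ℝ) 1) (hpq : ∀ i, p i ≤ q i) (n k t : ℕ) :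
    delayCDF q n k t ≤ delayCDF p n k t :=
  Finset.prod_le_prod (fun i _ => (tailProb_mem_Icc (hq i) _ k).1)
    fun i _ => tailProb_anti (hp i) (hq i) (hpq i) t k

lemma delayCDF_le_tailProb {p : ℕ → ℝ} (hp : ∀ i, p i ∈ Set.Icc (0 : ℝ) 1) {n i : ℕ} (hi : i < n)
    (k t : ℕ) : delayCDF p n k t ≤ tailProb (p i) t k := by
  have hi : i ∈ Finset.range n := Finset.mem_range.2 hi
  rw [delayCDF, ← Finset.mul_prod_erase _ _ hi]
  refine mul_le_of_le_one_right (tailProb_mem_Icc (hp i) t k).1 ?_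
  exact Finset.prod_le_one (fun i _ => (tailProb_mem_Icc (hp i) t k).1)
      fun i _ => (tailProb_mem_Icc (hp i) t k).2

lemma one_sub_delayCDF_le_sum {p : ℕ → ℝ} (hp : ∀ i, p i ∈ Set.Icc (0 : ℝ) 1) (n k t : ℕ) :
    1 - delayCDF p n k t ≤ ∑ i ∈ Finset.range n, (1 - tailProb (p i) t k) := by
  induction n with
  | zero => simp [delayCDF]
  | succ n ih =>
    have h := delayCDF_mem_Icc hp n k t
    have h' := tailProb_mem_Icc (hp n) t k
    rw [Finset.sum_range_succ]
    have : delayCDF p (n + 1) k t = delayCDF p n k t * tailProb (p n) t k :=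
      Finset.prod_range_succ _ _
    rw [this]
    nlinarith [h.1, h.2, h'.1, h'.2]

/-- A union bound over the users, each replaced by a worst-case user with erasure probability `q`,
followed by Chernoff's bound. -/
lemma one_sub_delayCDF_le {p : ℕ → ℝ} (hp : ∀ i, p i ∈ Set.Icc (0 : ℝ) 1) {q θ : ℝ} {n : ℕ}
    (hq : q ∈ Set.Icc (0 : ℝ) 1) (hpq : ∀ i < n, p i ≤ q) (hθ : 0 ≤ θ) (k t : ℕ) :
    1 - delayCDF p n k t ≤ n * (Real.exp (θ * k) * (q + (1 - q) * Real.exp (-θ)) ^ t) := by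
  refine (one_sub_delayCDF_le_sum hp n k t).trans ?_
  calc _ ≤ ∑ i ∈ Finset.range n, (Real.exp (θ * k) * (q + (1 - q) * Real.exp (-θ)) ^ t) :=
        Finset.sum_le_sum fun i hi => ?_
    _ = _ := by simp
  have := tailProb_anti (hp i) hq (hpq i (Finset.mem_range.1 hi)) t k
  have := one_sub_tailProb_le hq hθ t k
  linarith

/-! ### Events determined by finitely many channel states -/

/-- The event `A` is determined by the channel states at the pairs of a user and a slot in `S`. -/
def DeterminedBy {Ω : Type*} (C : ℕ → ℕ → Ω → Bool) (S : Finset (ℕ × ℕ)) (A : Set Ω) : Prop :=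
  ∀ ω ω', (∀ x ∈ S, C x.1 x.2 ω = C x.1 x.2 ω') → ω ∈ A → ω' ∈ A

section DeterminedBy

variable {Ω : Type*} {C : ℕ → ℕ → Ω → Bool} {S S' : Finset (ℕ × ℕ)} {A B : Set Ω}

lemma DeterminedBy.mono (h : DeterminedBy C S A) (hS : S ⊆ S') : DeterminedBy C S' A :=
  fun ω ω' hω => h ω ω' fun x hx => hω x (hS hx)

lemma DeterminedBy.inter (hA : DeterminedBy C S A) (hB : DeterminedBy C S B) :
    DeterminedBy C S (A ∩ B) :=
  fun ω ω' hω h => ⟨hA ω ω' hω h.1, hB ω ω' hω h.2⟩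

lemma DeterminedBy.compl (hA : DeterminedBy C S A) : DeterminedBy C S Aᶜ :=
  fun ω ω' hω h h' => h (hA ω' ω (fun x hx => (hω x hx).symm) h')

/-- Restriction to the states in `S` takes values in a finite type, where every set is measurable.
Measurability and independence of determined events follow from this form. -/
lemma DeterminedBy.eq_preimage (hA : DeterminedBy C S A) :
    A = (fun ω (x : S) => C x.1.1 x.1.2 ω) ⁻¹' ((fun ω (x : S) => C x.1.1 x.1.2 ω) '' A) := by
  refine Set.Subset.antisymm (Set.subset_preimage_image _ _) ?_
  rintro ω ⟨ω', hω', h⟩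
  exact hA ω' ω (fun x hx => congrFun h ⟨x, hx⟩) hω'

variable [MeasurableSpace Ω] {P : Measure Ω} {p : ℕ → ℝ}

lemma IsErasureSystem.measurableSet (hC : IsErasureSystem P p C) (hA : DeterminedBy C S A) :
    MeasurableSet A := by
  rw [hA.eq_preimage]
  exact (measurable_pi_lambda _ fun x => hC.measurable _ _) (Set.toFinite _).measurableSet

lemma IsErasureSystem.measure_inter (hC : IsErasureSystem P p C) (hA : DeterminedBy C S A)
    (hB : DeterminedBy C S' B) (h : Disjoint S S') : P (A ∩ B) = P A * P B := by
  have hi := hC.indep.indepFun_finset S S' h fun x => hC.measurable _ _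
  have := hi.measure_inter_preimage_eq_mul _ _
    (Set.toFinite ((fun ω (x : S) => C x.1.1 x.1.2 ω) '' A)).measurableSet
    (Set.toFinite ((fun ω (x : S') => C x.1.1 x.1.2 ω) '' B)).measurableSet
  rwa [← hA.eq_preimage, ← hB.eq_preimage] at this

lemma IsErasureSystem.real_inter (hC : IsErasureSystem P p C) (hA : DeterminedBy C S A)
    (hB : DeterminedBy C S' B) (h : Disjoint S S') :
    P.real (A ∩ B) = P.real A * P.real B := by
  simp only [measureReal_def, hC.measure_inter hA hB h, ENNReal.toReal_mul]

end DeterminedBy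

/-! ### Counts of received packets -/

section received

variable {Ω : Type*} (C : ℕ → ℕ → Ω → Bool)

@[simp] lemma received_zero (i s : ℕ) (ω : Ω) : received C i s 0 ω = 0 := by
  simp [received]

lemma received_succ (i s u : ℕ) (ω : Ω) :
    received C i s (u + 1) ω =
      received C i s u ω + if C i (s + u + 1) ω = true then 1 else 0 := by
  have : Finset.Ioc s (s + (u + 1)) = insert (s + u + 1) (Finset.Ioc s (s + u)) := by
    ext x; simp only [Finset.mem_Ioc, Finset.mem_insert]; omega
  rw [received, this, Finset.filter_insert]
  split_ifs with h
  · rw [Finset.card_insert_of_notMem (by simp)]; rfl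
  · rfl

lemma received_monotone (i s : ℕ) (ω : Ω) : Monotone fun u => received C i s u ω :=
  monotone_nat_of_le_succ fun u => by rw [received_succ]; exact Nat.le_add_right _ _

lemma determinedBy_le_received (i s u k : ℕ) :
    DeterminedBy C ({i} ×ˢ Finset.Ioc s (s + u)) {ω | k ≤ received C i s u ω} := by
  intro ω ω' h hω
  have : received C i s u ω' = received C i s u ω := by
    unfold received
    congr 1
    refine Finset.filter_congr fun τ hτ => ?_
    rw [h (i, τ) (by simpa using hτ)]
  simpa [this] using hω

lemma determinedBy_forall_le_received (n s u k : ℕ) :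
    DeterminedBy C (Finset.range n ×ˢ Finset.Ioc s (s + u))
      {ω | ∀ i < n, k ≤ received C i s u ω} := fun ω ω' h hω i hi =>
  (determinedBy_le_received C i s u k).mono (Finset.product_subset_product_left
    (by simpa using hi)) ω ω' h (hω i hi)

variable {C} [MeasurableSpace Ω] {P : Measure Ω} [IsProbabilityMeasure P] {p : ℕ → ℝ}

lemma IsErasureSystem.real_le_received (hp : ∀ i, p i ∈ Set.Icc (0 : ℝ) 1)
    (hC : IsErasureSystem P p C) (i s u k : ℕ) :
    P.real {ω | k ≤ received C i s u ω} = tailProb (p i) u k := by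
  induction u generalizing k with
  | zero => cases k <;> simp
  | succ u ih =>
    cases k with
    | zero => simp
    | succ k =>
      have hd : DeterminedBy C {(i, s + u + 1)} {ω | C i (s + u + 1) ω = false} := by
        intro ω ω' h hω
        have := h (i, s + u + 1) (by simp)
        simp_all
      have hdisj : Disjoint ({i} ×ˢ Finset.Ioc s (s + u)) {(i, s + u + 1)} := by simp
      have hf : P.real {ω | C i (s + u + 1) ω = false} = p i := by
        rw [measureReal_def, hC.law, ENNReal.toReal_ofReal (hp i).1]
      have ht : P.real {ω | C i (s + u + 1) ω = false}ᶜ = 1 - p i := by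
        rw [probReal_compl_eq_one_sub (hC.measurableSet hd), hf]
      -- Splitting by the state in the last slot reproduces the recursion of `tailProb`; that slot
      -- is independent of the earlier ones.
      rw [tailProb_succ_succ, ← ih, ← ih, ← measureReal_inter_add_sdiff (hC.measurableSet hd)]
      congr 1
      · rw [mul_comm, ← hf, ← hC.real_inter (determinedBy_le_received C i s u (k + 1)) hd hdisj]
        congr 1
        ext ω
        simp +contextual [received_succ]
      · rw [mul_comm, ← ht,
          ← hC.real_inter (determinedBy_le_received C i s u k) hd.compl hdisj]
        congr 1
        ext ω
        simp +contextual [received_succ]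

lemma IsErasureSystem.real_forall_le_received (hp : ∀ i, p i ∈ Set.Icc (0 : ℝ) 1)
    (hC : IsErasureSystem P p C) (n s u k : ℕ) :
    P.real {ω | ∀ i < n, k ≤ received C i s u ω} = delayCDF p n k u := by
  induction n with
  | zero => simp [delayCDF]
  | succ n ih =>
    rw [delayCDF, Finset.prod_range_succ, ← delayCDF, ← ih, ← hC.real_le_received hp n s u k,
      ← hC.real_inter (determinedBy_forall_le_received C n s u k)
        (determinedBy_le_received C n s u k)]
    · congr 1
      ext ω
      exact Nat.forall_lt_succ_right
    · rw [Finset.disjoint_left]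
      rintro ⟨a, b⟩ ha hb
      simp only [Finset.mem_product, Finset.mem_range, Finset.mem_singleton] at ha hb
      omega

end received

/-! ### The delay counted from a fixed slot -/

section delayFrom

variable {Ω : Type*} (C : ℕ → ℕ → Ω → Bool)

lemma userDelayFrom_le_iff (k i m u : ℕ) (ω : Ω) :
    userDelayFrom C k i m ω ≤ u ↔ k ≤ received C i m u ω := by
  constructor
  · intro h
    -- A strict bound is needed to extract a witness from the infimum.
    have h : userDelayFrom C k i m ω < (u + 1 : ℕ) := lt_of_le_of_lt h (by norm_cast; omega)
    simp only [userDelayFrom, iInf_lt_iff] at h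
    obtain ⟨m', u', ⟨hm, hk⟩, hu⟩ := h
    norm_cast at hm hu
    subst hm
    exact hk.trans (received_monotone C i m ω (by omega))
  · exact fun h => iInf_le_of_le m (iInf_le_of_le u (iInf_le_of_le ⟨rfl, h⟩ le_rfl))

lemma delayFrom_le_iff (n k m u : ℕ) (ω : Ω) :
    delayFrom C n k m ω ≤ u ↔ ∀ i < n, k ≤ received C i m u ω := by
  simp only [delayFrom, iSup_le_iff, userDelayFrom_le_iff]
  exact ⟨fun h i hi => h ⟨i, hi⟩, fun h i => h i i.2⟩

lemma userDelayFrom_top (k i : ℕ) (ω : Ω) : userDelayFrom C k i ⊤ ω = ⊤ := by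
  simp [userDelayFrom]

lemma delayFrom_top {n : ℕ} (hn : n ≠ 0) (k : ℕ) (ω : Ω) : delayFrom C n k ⊤ ω = ⊤ :=
  top_le_iff.1 ((userDelayFrom_top C k 0 ω).ge.trans
    (le_iSup (fun i : Fin n => userDelayFrom C k i ⊤ ω) ⟨0, Nat.pos_of_ne_zero hn⟩))

lemma delayFrom_zero_users (k : ℕ) (s : ℕ∞) (ω : Ω) : delayFrom C 0 k s ω = 0 := by
  simp [delayFrom]

lemma determinedBy_delayFrom_le (n k m u : ℕ) :
    DeterminedBy C (Finset.range n ×ˢ Finset.Ioc m (m + u)) {ω | delayFrom C n k m ω ≤ u} := by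
  simpa only [delayFrom_le_iff] using determinedBy_forall_le_received C n m u k

/-- The probability mass function of the delay of a block. -/
noncomputable def delayPMF (p : ℕ → ℝ) (n k : ℕ) : ℕ → ℝ
  | 0 => delayCDF p n k 0
  | t + 1 => delayCDF p n k (t + 1) - delayCDF p n k t

lemma delayFrom_eq_succ (n k m u : ℕ) :
    {ω | delayFrom C n k m ω = (u + 1 : ℕ)} =
      {ω | delayFrom C n k m ω ≤ (u + 1 : ℕ)} ∩ {ω | delayFrom C n k m ω ≤ (u : ℕ)}ᶜ := by
  ext ω
  simp only [Set.mem_ofPred_eq, Set.mem_inter_iff, Set.mem_compl_iff, not_le]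
  generalize delayFrom C n k m ω = x
  induction x using ENat.recTopCoe with
  | top => simpa using ENat.top_ne_natCast (u + 1)
  | coe x => norm_cast; omega

lemma determinedBy_delayFrom_eq (n k m u : ℕ) :
    DeterminedBy C (Finset.range n ×ˢ Finset.Ioc m (m + u)) {ω | delayFrom C n k m ω = u} := by
  cases u with
  | zero => simpa using determinedBy_delayFrom_le C n k m 0
  | succ u =>
    rw [delayFrom_eq_succ]
    exact (determinedBy_delayFrom_le C n k m (u + 1)).inter
      ((determinedBy_delayFrom_le C n k m u).mono (Finset.product_subset_product_right
        (Finset.Ioc_subset_Ioc_right (by omega)))).compl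

variable {C} [MeasurableSpace Ω] {P : Measure Ω} [IsProbabilityMeasure P] {p : ℕ → ℝ}

lemma IsErasureSystem.real_delayFrom_le (hp : ∀ i, p i ∈ Set.Icc (0 : ℝ) 1)
    (hC : IsErasureSystem P p C) (n k m u : ℕ) :
    P.real {ω | delayFrom C n k m ω ≤ u} = delayCDF p n k u := by
  simpa only [delayFrom_le_iff] using hC.real_forall_le_received hp n m u k

lemma IsErasureSystem.real_delayFrom_eq (hp : ∀ i, p i ∈ Set.Icc (0 : ℝ) 1)
    (hC : IsErasureSystem P p C) (n k m u : ℕ) :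
    P.real {ω | delayFrom C n k m ω = u} = delayPMF p n k u := by
  cases u with
  | zero => simpa [delayPMF] using hC.real_delayFrom_le hp n k m 0
  | succ u =>
    rw [delayPMF, ← hC.real_delayFrom_le hp n k m, ← hC.real_delayFrom_le hp n k m,
      delayFrom_eq_succ, ← Set.sdiff_eq, measureReal_sdiff
        _ (hC.measurableSet (determinedBy_delayFrom_le C n k m u))]
    intro ω hω
    exact le_trans (show delayFrom C n k m ω ≤ u from hω) (Nat.cast_le.2 (Nat.le_succ u))

end delayFrom

/-! ### Completion times and regeneration at block starts -/

section completionTime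

variable {Ω : Type*} (C : ℕ → ℕ → Ω → Bool) (n k : ℕ)

@[simp] lemma completionTime_zero (ω : Ω) : completionTime C n k ω 0 = 0 := rfl

lemma completionTime_succ (ω : Ω) (j : ℕ) :
    completionTime C n k ω (j + 1) = completionTime C n k ω j + decodingDelay C n k j ω := rfl

lemma completionTime_monotone (ω : Ω) : Monotone (completionTime C n k ω) :=
  monotone_nat_of_le_succ fun j => by rw [completionTime_succ]; exact le_self_add

lemma decodingDelay_of_completionTime_eq {ω : Ω} {j m : ℕ} (h : completionTime C n k ω j = m) :
    decodingDelay C n k j ω = delayFrom C n k m ω := by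
  rw [decodingDelay, h]

lemma completionTime_ne_top_of_decodingDelay_ne_top {ω : Ω} {j : ℕ}
    (h : decodingDelay C n k j ω ≠ ⊤) : completionTime C n k ω j ≠ ⊤ := by
  intro hT
  -- Without users the delay from `⊤` is `0` rather than `⊤`, but then every completion time is `0`.
  rcases eq_or_ne n 0 with rfl | hn
  · have : ∀ j, completionTime C 0 k ω j = 0 := fun j => by
      induction j with
      | zero => rfl
      | succ j ih => rw [completionTime_succ, ih, decodingDelay, delayFrom_zero_users]; simp
    simp [this] at hT
  · exact h (by rw [decodingDelay, hT, delayFrom_top C hn])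

lemma completionTime_succ_ne_top_iff {ω : Ω} {j : ℕ} :
    completionTime C n k ω (j + 1) ≠ ⊤ ↔ decodingDelay C n k j ω ≠ ⊤ := by
  rw [completionTime_succ, Ne, ENat.add_eq_top, not_or]
  exact ⟨fun h => h.2, fun h => ⟨completionTime_ne_top_of_decodingDelay_ne_top C n k h, h⟩⟩

variable {C n k} in
/-- The completion times up to slot `m` are determined by the channel states up to slot `m`. -/
lemma completionTime_congr {ω ω' : Ω} {m : ℕ}
    (h : ∀ x ∈ Finset.range n ×ˢ Finset.Ioc 0 m, C x.1 x.2 ω = C x.1 x.2 ω') {j : ℕ}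
    (hj : completionTime C n k ω j ≤ m) :
    completionTime C n k ω' j = completionTime C n k ω j := by
  induction j with
  | zero => rfl
  | succ j ih =>
    have ih := ih ((completionTime_monotone C n k ω (Nat.le_succ j)).trans hj)
    have hne : completionTime C n k ω (j + 1) ≠ ⊤ := ne_top_of_le_ne_top (ENat.natCast_ne_top m) hj
    obtain ⟨d, hd⟩ := ENat.ne_top_iff_exists.1 ((completionTime_succ_ne_top_iff C n k).1 hne)
    obtain ⟨a, ha⟩ := ENat.ne_top_iff_exists.1 (completionTime_ne_top_of_decodingDelay_ne_top C n k
      ((completionTime_succ_ne_top_iff C n k).1 hne))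
    rw [completionTime_succ, ← ha, ← hd] at hj
    norm_cast at hj
    rw [completionTime_succ, completionTime_succ, ih]
    congr 1
    -- Block `j` starts after slot `a` on both sample points, and its delay `d` satisfies `a + d ≤
    -- m`, so only slots up to `m` matter.
    rw [decodingDelay_of_completionTime_eq C n k (ih.trans ha.symm), ← hd]
    rw [decodingDelay_of_completionTime_eq C n k ha.symm] at hd
    exact determinedBy_delayFrom_eq C n k a d ω ω' (fun x hx => h x
      (Finset.product_subset_product_right (Finset.Ioc_subset_Ioc (Nat.zero_le _) hj) hx)) hd.symm

lemma determinedBy_completionTime_eq (j m : ℕ) :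
    DeterminedBy C (Finset.range n ×ˢ Finset.Ioc 0 m) {ω | completionTime C n k ω j = m} := by
  intro ω ω' h hω
  have hω : completionTime C n k ω j = m := hω
  exact (completionTime_congr h hω.le).trans hω

/-- When block `j` starts after slot `m`, the earlier block `i` has ended by then, and its delay is
a difference of completion times known at slot `m`. This makes earlier delays admissible as the past
event in `measure_inter_delay`. -/
lemma determinedBy_decodingDelay_eq {i j : ℕ} (hij : i < j) (a m : ℕ) :
    DeterminedBy C (Finset.range n ×ˢ Finset.Ioc 0 m)
      ({ω | decodingDelay C n k i ω = a} ∩ {ω | completionTime C n k ω j = m}) := by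
  rintro ω ω' h ⟨h1, h2⟩
  have h1 : decodingDelay C n k i ω = a := h1
  have h2 : completionTime C n k ω j = m := h2
  refine ⟨?_, determinedBy_completionTime_eq C n k j m ω ω' h h2⟩
  have e := completionTime_congr h ((completionTime_monotone C n k ω hij).trans h2.le)
  have e' := completionTime_congr h ((completionTime_monotone C n k ω hij.le).trans h2.le)
  have hne : completionTime C n k ω i ≠ ⊤ := ne_top_of_le_ne_top (ENat.natCast_ne_top m)
    ((completionTime_monotone C n k ω hij.le).trans h2.le)
  rw [Nat.succ_eq_add_one, completionTime_succ, completionTime_succ, e', h1] at e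
  exact ENat.add_right_injective_of_ne_top hne e

variable {C n k} [MeasurableSpace Ω] {P : Measure Ω} {p : ℕ → ℝ}

/-- The block that starts after slot `m` is independent of the slots up to `m`. -/
lemma IsErasureSystem.measure_inter_delay (hC : IsErasureSystem P p C) {j u : ℕ} {A E : Set Ω}
    {B : ℕ → Set Ω} {c : ℝ≥0∞}
    (hA : ∀ m : ℕ, DeterminedBy C (Finset.range n ×ˢ Finset.Ioc 0 m)
      (A ∩ {ω | completionTime C n k ω j = m}))
    (hB : ∀ m, DeterminedBy C (Finset.range n ×ˢ Finset.Ioc m (m + u)) (B m))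
    (hc : ∀ m, P (B m) = c)
    (hEB : ∀ (m : ℕ) ω, completionTime C n k ω j = m → (ω ∈ E ↔ ω ∈ B m))
    (hE : ∀ ω ∈ E, completionTime C n k ω j ≠ ⊤) :
    P (A ∩ E) = P (A ∩ {ω | completionTime C n k ω j ≠ ⊤}) * c := by
  have hdisj : Pairwise (Function.onFun Disjoint
      fun m : ℕ => A ∩ {ω | completionTime C n k ω j = m}) := by
    intro m m' hm
    refine Set.disjoint_left.2 fun ω h1 h2 => hm ?_
    have h1 : completionTime C n k ω j = m := h1.2
    have h2 : completionTime C n k ω j = m' := h2.2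
    exact_mod_cast h1.symm.trans h2
  -- Partition by the starting slot `m`. On each piece `E` agrees with `B m`, which looks only at
  -- slots after `m` and has a probability that does not depend on `m`.
  have e1 : A ∩ E = ⋃ m : ℕ, (A ∩ {ω | completionTime C n k ω j = m}) ∩ B m := by
    ext ω
    simp only [Set.mem_iUnion, Set.mem_inter_iff, Set.mem_ofPred_eq]
    constructor
    · rintro ⟨hA, hω⟩
      obtain ⟨m, hm⟩ := ENat.ne_top_iff_exists.1 (hE ω hω)
      exact ⟨m, ⟨hA, hm.symm⟩, (hEB m ω hm.symm).1 hω⟩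
    · rintro ⟨m, ⟨hA, hm⟩, hω⟩
      exact ⟨hA, (hEB m ω hm).2 hω⟩
  have e2 : A ∩ {ω | completionTime C n k ω j ≠ ⊤} =
      ⋃ m : ℕ, A ∩ {ω | completionTime C n k ω j = m} := by
    ext ω
    simp only [Set.mem_iUnion, Set.mem_inter_iff, Set.mem_ofPred_eq, ENat.ne_top_iff_exists,
      exists_and_left, eq_comm]
  rw [e1, e2, measure_iUnion hdisj fun m => hC.measurableSet (hA m), measure_iUnion
    (fun m m' hm => (hdisj hm).mono Set.inter_subset_left Set.inter_subset_left)
    fun m => (hC.measurableSet (hA m)).inter (hC.measurableSet (hB m)), ← ENNReal.tsum_mul_right]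
  refine tsum_congr fun m => ?_
  rw [hC.measure_inter (hA m) (hB m), hc]
  rw [Finset.disjoint_left]
  rintro ⟨a, b⟩ ha hb
  simp only [Finset.mem_product, Finset.mem_range, Finset.mem_Ioc] at ha hb
  omega

lemma IsErasureSystem.measurable_completionTime (hC : IsErasureSystem P p C) (j : ℕ) :
    Measurable fun ω => completionTime C n k ω j :=
  ENat.measurable_iff.2 fun m => hC.measurableSet (determinedBy_completionTime_eq C n k j m)

lemma IsErasureSystem.measurable_decodingDelay (hC : IsErasureSystem P p C) (j : ℕ) :
    Measurable fun ω => decodingDelay C n k j ω := by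
  refine ENat.measurable_iff.2 fun a => ?_
  have : (fun ω => decodingDelay C n k j ω) ⁻¹' {(a : ℕ∞)} = ⋃ m : ℕ,
      {ω | decodingDelay C n k j ω = a} ∩ {ω | completionTime C n k ω (j + 1) = m} := by
    ext ω
    simp only [Set.mem_preimage, Set.mem_singleton_iff, Set.mem_iUnion, Set.mem_inter_iff,
      Set.mem_ofPred_eq, exists_and_left, iff_self_and]
    intro h
    obtain ⟨m, hm⟩ := ENat.ne_top_iff_exists.1
      ((completionTime_succ_ne_top_iff C n k).2 (h ▸ ENat.natCast_ne_top a))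
    exact ⟨m, hm.symm⟩
  rw [this]
  exact .iUnion fun m => hC.measurableSet
    (determinedBy_decodingDelay_eq C n k (Nat.lt_succ_self j) a m)

variable [IsProbabilityMeasure P]

/-- The first factor accounts for earlier blocks that may never end; it allows erasure probability
`1` without a case distinction. -/
lemma IsErasureSystem.real_decodingDelay_le (hp : ∀ i, p i ∈ Set.Icc (0 : ℝ) 1)
    (hC : IsErasureSystem P p C) (j t : ℕ) :
    P.real {ω | decodingDelay C n k j ω ≤ t} =
      P.real {ω | completionTime C n k ω j ≠ ⊤} * delayCDF p n k t := by
  have h := hC.measure_inter_delay (n := n) (k := k) (j := j) (u := t) (A := Set.univ)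
    (E := {ω | decodingDelay C n k j ω ≤ t}) (B := fun m => {ω | delayFrom C n k m ω ≤ t})
    (c := P {ω | delayFrom C n k (0 : ℕ) ω ≤ t})
    (fun m => by simpa using determinedBy_completionTime_eq C n k j m)
    (fun m => determinedBy_delayFrom_le C n k m t)
    (fun m => (measureReal_eq_measureReal_iff).1
      ((hC.real_delayFrom_le hp n k m t).trans (hC.real_delayFrom_le hp n k 0 t).symm))
    (fun m ω hm => by
      simp only [Set.mem_ofPred_eq, decodingDelay_of_completionTime_eq C n k hm])
    (fun ω hω => completionTime_ne_top_of_decodingDelay_ne_top C n k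
      (ne_top_of_le_ne_top (ENat.natCast_ne_top t) hω))
  rw [Set.univ_inter, Set.univ_inter] at h
  rw [measureReal_def, h, ENNReal.toReal_mul, ← measureReal_def, ← measureReal_def,
    hC.real_delayFrom_le hp]

lemma IsErasureSystem.real_inter_decodingDelay_eq (hp : ∀ i, p i ∈ Set.Icc (0 : ℝ) 1)
    (hC : IsErasureSystem P p C) {j : ℕ} (t : ℕ) {A : Set Ω}
    (hA : ∀ m : ℕ, DeterminedBy C (Finset.range n ×ˢ Finset.Ioc 0 m)
      (A ∩ {ω | completionTime C n k ω j = m})) :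
    P.real (A ∩ {ω | decodingDelay C n k j ω = t}) =
      P.real (A ∩ {ω | completionTime C n k ω j ≠ ⊤}) * delayPMF p n k t := by
  have h := hC.measure_inter_delay (n := n) (k := k) (j := j) (u := t) (A := A)
    (E := {ω | decodingDelay C n k j ω = t}) (B := fun m => {ω | delayFrom C n k m ω = t})
    (c := P {ω | delayFrom C n k (0 : ℕ) ω = t}) hA
    (fun m => determinedBy_delayFrom_eq C n k m t)
    (fun m => (measureReal_eq_measureReal_iff).1
      ((hC.real_delayFrom_eq hp n k m t).trans (hC.real_delayFrom_eq hp n k 0 t).symm))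
    (fun m ω hm => by
      simp only [Set.mem_ofPred_eq, decodingDelay_of_completionTime_eq C n k hm])
    (fun ω hω => completionTime_ne_top_of_decodingDelay_ne_top C n k
      (by rw [show decodingDelay C n k j ω = t from hω]; exact ENat.natCast_ne_top t))
  rw [measureReal_def, h, ENNReal.toReal_mul, ← measureReal_def, ← measureReal_def,
    hC.real_delayFrom_eq hp]

lemma tendsto_delayCDF (hp : ∀ i, p i ∈ Set.Icc (0 : ℝ) 1) (n k : ℕ) :
    Tendsto (delayCDF p n k) atTop (𝓝 (⨆ t, delayCDF p n k t)) :=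
  tendsto_atTop_ciSup (delayCDF_monotone hp n k)
    ⟨1, by rintro _ ⟨t, rfl⟩; exact (delayCDF_mem_Icc hp n k t).2⟩

/-- Letting `t → ∞` in `real_decodingDelay_le` shows that each block contributes one factor, the
limit of the distribution function. -/
lemma IsErasureSystem.real_completionTime_ne_top (hp : ∀ i, p i ∈ Set.Icc (0 : ℝ) 1)
    (hC : IsErasureSystem P p C) (j : ℕ) :
    P.real {ω | completionTime C n k ω j ≠ ⊤} = (⨆ t, delayCDF p n k t) ^ j := by
  induction j with
  | zero => simp
  | succ j ih =>
    have e : {ω | completionTime C n k ω (j + 1) ≠ ⊤} =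
        ⋃ t : ℕ, {ω | decodingDelay C n k j ω ≤ t} := by
      ext ω
      simp only [Set.mem_ofPred_eq, Set.mem_iUnion, completionTime_succ_ne_top_iff]
      exact ⟨fun h => (ENat.ne_top_iff_exists.1 h).imp fun _ h => h.ge,
        fun ⟨t, ht⟩ => ne_top_of_le_ne_top (ENat.natCast_ne_top t) ht⟩
    have h : Tendsto (fun t : ℕ => P.real {ω | decodingDelay C n k j ω ≤ t}) atTop
        (𝓝 (P.real {ω | completionTime C n k ω (j + 1) ≠ ⊤})) := by
      rw [e]
      refine (ENNReal.tendsto_toReal (measure_ne_top _ _)).comp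
        (tendsto_measure_iUnion_atTop fun s t hst ω hω => ?_)
      exact le_trans (show decodingDelay C n k j ω ≤ s from hω) (Nat.cast_le.2 hst)
    simp_rw [hC.real_decodingDelay_le hp, ih] at h
    rw [pow_succ]
    exact tendsto_nhds_unique h ((tendsto_delayCDF hp n k).const_mul _)

end completionTime

/-! ### Mean delays and comparison of two systems -/

lemma ENat.toENNReal_eq_tsum (x : ℕ∞) :
    (x : ℝ≥0∞) = ∑' t : ℕ, if (t : ℕ∞) < x then 1 else 0 := by
  induction x using ENat.recTopCoe with
  | top => simp
  | coe m =>
    rw [tsum_eq_sum (s := Finset.range m) fun t ht => by simpa using ht]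
    rw [Finset.sum_congr rfl fun t ht => if_pos (by simpa using ht)]
    simp

section meanDelay

variable {Ω : Type*} {C : ℕ → ℕ → Ω → Bool} [MeasurableSpace Ω] {P : Measure Ω}
  [IsProbabilityMeasure P] {p : ℕ → ℝ}

lemma IsErasureSystem.meanDelay_eq_tsum_measure (hC : IsErasureSystem P p C) (n k j : ℕ) :
    meanDelay P C n k j =
      ∑' t : ℕ, ENNReal.ofReal (1 - P.real {ω | decodingDelay C n k j ω ≤ t}) := by
  have hm : ∀ t : ℕ, MeasurableSet {ω | decodingDelay C n k j ω ≤ t} := fun t =>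
    hC.measurable_decodingDelay j (MeasurableSet.of_discrete (s := Set.Iic (t : ℕ∞)))
  unfold meanDelay
  simp_rw [ENat.toENNReal_eq_tsum]
  have hite : ∀ (t : ℕ) ω, (if (t : ℕ∞) < decodingDelay C n k j ω then (1 : ℝ≥0∞) else 0) =
      {ω | decodingDelay C n k j ω ≤ t}ᶜ.indicator 1 ω := fun t ω => by
    simp [Set.indicator_apply]
  simp_rw [hite]
  rw [lintegral_tsum fun t => (measurable_one.indicator (hm t).compl).aemeasurable]
  refine tsum_congr fun t => ?_
  rw [lintegral_indicator_one (hm t).compl, ← probReal_compl_eq_one_sub (hm t), measureReal_def,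
    ENNReal.ofReal_toReal (measure_ne_top _ _)]

/-- The mean delay of the first block, in terms of its distribution function. -/
noncomputable def meanDelayOf (p : ℕ → ℝ) (n k : ℕ) : ℝ≥0∞ :=
  ∑' t : ℕ, ENNReal.ofReal (1 - delayCDF p n k t)

lemma IsErasureSystem.meanDelay_zero (hp : ∀ i, p i ∈ Set.Icc (0 : ℝ) 1)
    (hC : IsErasureSystem P p C) (n k : ℕ) : meanDelay P C n k 0 = meanDelayOf p n k := by
  rw [hC.meanDelay_eq_tsum_measure, meanDelayOf]
  simp [hC.real_decodingDelay_le hp]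

variable {Ω' : Type*} {C' : ℕ → ℕ → Ω' → Bool} [MeasurableSpace Ω'] {P' : Measure Ω'}
  [IsProbabilityMeasure P'] {q : ℕ → ℝ}

lemma IsErasureSystem.real_decodingDelay_le_mono (hp : ∀ i, p i ∈ Set.Icc (0 : ℝ) 1)
    (hq : ∀ i, q i ∈ Set.Icc (0 : ℝ) 1) (hC : IsErasureSystem P p C)
    (hC' : IsErasureSystem P' q C') (hpq : ∀ i, p i ≤ q i) (n k j t : ℕ) :
    P'.real {ω | decodingDelay C' n k j ω ≤ t} ≤ P.real {ω | decodingDelay C n k j ω ≤ t} := by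
  have h := delayCDF_anti hp hq hpq n k
  rw [hC.real_decodingDelay_le hp, hC'.real_decodingDelay_le hq, hC.real_completionTime_ne_top hp,
    hC'.real_completionTime_ne_top hq]
  have h0 : 0 ≤ ⨆ t, delayCDF q n k t := Real.iSup_nonneg fun t => (delayCDF_mem_Icc hq n k t).1
  have h1 : ⨆ t, delayCDF q n k t ≤ ⨆ t, delayCDF p n k t :=
    le_of_tendsto_of_tendsto' (tendsto_delayCDF hq n k) (tendsto_delayCDF hp n k) h
  exact mul_le_mul (pow_le_pow_left₀ h0 h1 j) (h t) (delayCDF_mem_Icc hq n k t).1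
    (pow_nonneg (h0.trans h1) j)

end meanDelay

/-! ### Bounds on the mean delay -/

lemma meanDelayOf_anti {p q : ℕ → ℝ} (hp : ∀ i, p i ∈ Set.Icc (0 : ℝ) 1)
    (hq : ∀ i, q i ∈ Set.Icc (0 : ℝ) 1) (hpq : ∀ i, p i ≤ q i) (n k : ℕ) :
    meanDelayOf p n k ≤ meanDelayOf q n k :=
  ENNReal.tsum_le_tsum fun t => ENNReal.ofReal_le_ofReal
    (sub_le_sub_left (delayCDF_anti hp hq hpq n k t) 1)

lemma delayCDF_zero {p : ℕ → ℝ} (hp : ∀ i, p i ∈ Set.Icc (0 : ℝ) 1) {n k : ℕ} (hn : 1 ≤ n)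
    (hk : 1 ≤ k) : delayCDF p n k 0 = 0 := by
  obtain ⟨k, rfl⟩ := Nat.exists_eq_add_of_le' hk
  refine le_antisymm ?_ (delayCDF_mem_Icc hp n _ 0).1
  simpa using delayCDF_le_tailProb hp (i := 0) hn (k + 1) 0

lemma one_le_meanDelayOf {p : ℕ → ℝ} (hp : ∀ i, p i ∈ Set.Icc (0 : ℝ) 1) {n k : ℕ} (hn : 1 ≤ n)
    (hk : 1 ≤ k) : 1 ≤ meanDelayOf p n k := by
  have := ENNReal.le_tsum (f := fun t => ENNReal.ofReal (1 - delayCDF p n k t)) 0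
  simpa [meanDelayOf, delayCDF_zero hp hn hk] using this

lemma summable_of_meanDelayOf_ne_top {p : ℕ → ℝ} (hp : ∀ i, p i ∈ Set.Icc (0 : ℝ) 1) {n k : ℕ}
    (h : meanDelayOf p n k ≠ ⊤) : Summable fun t => 1 - delayCDF p n k t := by
  have := ENNReal.summable_toReal h
  refine this.congr fun t => ENNReal.toReal_ofReal ?_
  linarith [(delayCDF_mem_Icc hp n k t).2]

/-- The mean delay is at least that of a single user. -/
lemma natCast_le_mul_meanDelayOf {p : ℕ → ℝ} (hp : ∀ i, p i ∈ Set.Icc (0 : ℝ) 1) {n k i : ℕ}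
    (hi : i < n) (h : meanDelayOf p n k ≠ ⊤) :
    (k : ℝ) ≤ (1 - p i) * (meanDelayOf p n k).toReal := by
  have hs := summable_of_meanDelayOf_ne_top hp h
  have hle : ∀ t, 1 - tailProb (p i) t k ≤ 1 - delayCDF p n k t := fun t =>
    sub_le_sub_left (delayCDF_le_tailProb hp hi k t) 1
  have hs' : Summable fun t => 1 - tailProb (p i) t k :=
    hs.of_nonneg_of_le (fun t => by linarith [(tailProb_mem_Icc (hp i) t k).2]) hle
  have e : (meanDelayOf p n k).toReal = ∑' t, (1 - delayCDF p n k t) := by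
    have h0 : ∀ t, 0 ≤ 1 - delayCDF p n k t := fun t => by linarith [(delayCDF_mem_Icc hp n k t).2]
    rw [meanDelayOf, ← ENNReal.ofReal_tsum_of_nonneg h0 hs, ENNReal.toReal_ofReal (tsum_nonneg h0)]
  rw [e, ← mul_tsum_one_sub_tailProb (hp i) k hs']
  exact mul_le_mul_of_nonneg_left (hs'.tsum_le_tsum hle hs) (by linarith [(hp i).2])

/-- An upper bound on the mean delay: about `a * k` slots for every `a > 1 / (1 - q)`, up to a term
that is small as soon as `k` is large compared with the logarithm of the number of users. -/
lemma exists_meanDelayOf_le {q a : ℝ} (hq : q ∈ Set.Icc (0 : ℝ) 1) (ha : 1 < a * (1 - q)) :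
    ∃ δ > 0, ∃ B ≥ 0, ∀ (p : ℕ → ℝ) (n k : ℕ), (∀ i, p i ∈ Set.Icc (0 : ℝ) 1) →
      (∀ i < n, p i ≤ q) →
      meanDelayOf p n k ≤ ENNReal.ofReal (a * k + 1 + B * (n * Real.exp (-δ * k))) := by
  obtain ⟨hq0, hq1⟩ := id hq
  have hq1' : q < 1 := lt_of_le_of_ne hq1 fun h => by subst h; norm_num at ha
  have ha0 : 0 < a := by
    by_contra! h
    nlinarith
  -- Since `1 - exp (-θ) ≥ θ / (1 + θ)`, the inequality `θ < a * s` holds once `1 + θ < a * (1 -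
  -- q)`; half of the surplus over `1` achieves this.
  set θ : ℝ := (a * (1 - q) - 1) / 2 with hθ
  have hθ0 : 0 < θ := by linarith
  set s : ℝ := (1 - q) * (1 - Real.exp (-θ)) with hs
  have hexp : θ < a * s := by
    have h1 : Real.exp (-θ) * (1 + θ) ≤ 1 := by
      have := Real.add_one_le_exp θ
      calc Real.exp (-θ) * (1 + θ) ≤ Real.exp (-θ) * Real.exp θ := by
            gcongr; linarith
        _ = 1 := by rw [← Real.exp_add]; simp
    have h2 : θ ≤ (1 - Real.exp (-θ)) * (1 + θ) := by linarith
    have h3 : 1 + θ < a * (1 - q) := by linarith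
    have h4 : 0 < 1 - Real.exp (-θ) := by
      have : Real.exp (-θ) < 1 := Real.exp_lt_one_iff.2 (by linarith)
      linarith
    calc θ ≤ (1 - Real.exp (-θ)) * (1 + θ) := h2
      _ < (1 - Real.exp (-θ)) * (a * (1 - q)) := by gcongr
      _ = a * s := by rw [hs]; ring
  have hs0 : 0 < s := by
    by_contra! h
    nlinarith
  have hρ1 : Real.exp (-s) < 1 := Real.exp_lt_one_iff.2 (by linarith)
  have hr : q + (1 - q) * Real.exp (-θ) ≤ Real.exp (-s) := by
    have := Real.add_one_le_exp (-s)
    have : q + (1 - q) * Real.exp (-θ) = -s + 1 := by rw [hs]; ring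
    linarith
  have hr0 : 0 ≤ q + (1 - q) * Real.exp (-θ) :=
    add_nonneg hq0 (mul_nonneg (by linarith) (Real.exp_pos _).le)
  -- `δ` is the decay rate left in `exp (θ k) * exp (-s t)` at `t = a k`, and `B` is the sum of the
  -- geometric series of ratio `exp (-s)`.
  refine ⟨a * s - θ, by linarith, (1 - Real.exp (-s))⁻¹, inv_nonneg.2 (by linarith),
    fun p n k hp hpq => ?_⟩
  have hG : ∀ t : ℕ, 1 - delayCDF p n k t ≤ n * (Real.exp (θ * k) * Real.exp (-s) ^ t) := fun t =>
    (one_sub_delayCDF_le hp hq hpq hθ0.le k t).trans (by gcongr)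
  -- The first `T` tail probabilities are bounded by `1`, the later ones by the geometric series.
  set T := ⌈a * k⌉₊ with hT
  have hT1 : a * k ≤ T := Nat.le_ceil _
  have hT2 : (T : ℝ) ≤ a * k + 1 := (Nat.ceil_lt_add_one (by positivity)).le
  have hG' : ∀ t : ℕ, 1 - delayCDF p n k (t + T) ≤
      n * Real.exp (-(a * s - θ) * k) * Real.exp (-s) ^ t := fun t => by
    refine (hG (t + T)).trans ?_
    have : Real.exp (θ * k) * Real.exp (-s) ^ T ≤ Real.exp (-(a * s - θ) * k) := by
      rw [← Real.exp_nat_mul, ← Real.exp_add]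
      refine Real.exp_le_exp.2 ?_
      nlinarith
    calc (n : ℝ) * (Real.exp (θ * k) * Real.exp (-s) ^ (t + T))
        = n * (Real.exp (θ * k) * Real.exp (-s) ^ T) * Real.exp (-s) ^ t := by
          rw [pow_add]; ring
      _ ≤ _ := by gcongr
  have hgeo := (summable_geometric_of_lt_one (Real.exp_pos (-s)).le hρ1).mul_left
    (n * Real.exp (-(a * s - θ) * k))
  calc meanDelayOf p n k
      = ∑ t ∈ Finset.range T, ENNReal.ofReal (1 - delayCDF p n k t) +
          ∑' t, ENNReal.ofReal (1 - delayCDF p n k (t + T)) :=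
        (ENNReal.summable.sum_add_tsum_nat_add').symm
    _ ≤ ∑ t ∈ Finset.range T, 1 +
          ∑' t, ENNReal.ofReal (n * Real.exp (-(a * s - θ) * k) * Real.exp (-s) ^ t) := by
        gcongr with t ht t
        · rw [← ENNReal.ofReal_one]
          exact ENNReal.ofReal_le_ofReal (by linarith [(delayCDF_mem_Icc hp n k t).1])
        · exact hG' t
    _ = ENNReal.ofReal (T + (1 - Real.exp (-s))⁻¹ * (n * Real.exp (-(a * s - θ) * k))) := by
        rw [← ENNReal.ofReal_tsum_of_nonneg (fun t => by positivity) hgeo, tsum_mul_left,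
          tsum_geometric_of_lt_one (Real.exp_pos _).le hρ1, ENNReal.ofReal_add (by positivity)]
        · simp [mul_comm]
        · have : 0 ≤ (1 - Real.exp (-s))⁻¹ := inv_nonneg.2 (by linarith)
          positivity
    _ ≤ _ := ENNReal.ofReal_le_ofReal (by linarith)

/-! ### The candidate throughput and its bounds -/

/-- The throughput `k / 𝔼[U]`; it is `0` if the mean delay is infinite. -/
noncomputable def throughput (p : ℕ → ℝ) (n k : ℕ) : ℝ := k / (meanDelayOf p n k).toReal

lemma throughput_nonneg (p : ℕ → ℝ) (n k : ℕ) : 0 ≤ throughput p n k := by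
  unfold throughput; positivity

lemma throughput_le {p : ℕ → ℝ} (hp : ∀ i, p i ∈ Set.Icc (0 : ℝ) 1) {n k i : ℕ} (hi : i < n) :
    throughput p n k ≤ 1 - p i := by
  have h1 : 0 ≤ 1 - p i := by linarith [(hp i).2]
  by_cases h : meanDelayOf p n k = ⊤
  · simpa [throughput, h] using h1
  · exact div_le_of_le_mul₀ ENNReal.toReal_nonneg h1 (natCast_le_mul_meanDelayOf hp hi h)

lemma throughput_anti {p q : ℕ → ℝ} (hp : ∀ i, p i ∈ Set.Icc (0 : ℝ) 1)
    (hq : ∀ i, q i ∈ Set.Icc (0 : ℝ) 1) (hpq : ∀ i, p i ≤ q i) {n k : ℕ} (hn : 1 ≤ n)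
    (hk : 1 ≤ k) : throughput q n k ≤ throughput p n k := by
  by_cases h : meanDelayOf q n k = ⊤
  · simpa [throughput, h] using throughput_nonneg p n k
  · have hle := meanDelayOf_anti hp hq hpq n k
    have hpos : 0 < (meanDelayOf p n k).toReal := ENNReal.toReal_pos
      (zero_lt_one.trans_le (one_le_meanDelayOf hp hn hk)).ne' (ne_top_of_le_ne_top h hle)
    exact div_le_div_of_nonneg_left (Nat.cast_nonneg k) hpos (ENNReal.toReal_mono h hle)

/-- The throughput exceeds every `c < 1 - q` in the limit if `k → ∞` fast enough. -/
lemma eventually_lt_throughput {p : ℕ → ℝ} (hp : ∀ i, p i ∈ Set.Icc (0 : ℝ) 1) {q c : ℝ}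
    (hq : q ∈ Set.Icc (0 : ℝ) 1) {n k : ℕ → ℕ} (hpq : ∀ x, ∀ i < n x, p i ≤ q)
    (hn : ∀ x, 1 ≤ x → 1 ≤ n x)
    (hk : Tendsto (fun x => (k x : ℝ)) atTop atTop)
    (hnk : ∀ δ > 0, ∀ᶠ x in atTop, n x * Real.exp (-δ * k x) ≤ 1) (hc : c < 1 - q) :
    ∀ᶠ x in atTop, c < throughput p (n x) (k x) := by
  rcases lt_or_ge c 0 with hc0 | hc0
  · exact .of_forall fun x => hc0.trans_le (throughput_nonneg _ _ _)
  obtain ⟨b, hcb, hb⟩ := exists_between hc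
  have hb0 : 0 < b := hc0.trans_lt hcb
  obtain ⟨δ, hδ, B, hB, h⟩ := exists_meanDelayOf_le (a := b⁻¹) hq
    (by rw [inv_mul_eq_div, one_lt_div hb0]; exact hb)
  -- Once `n * exp (-δ k) ≤ 1`, the mean delay is at most `k / b + 1 + B`, so this sequence bounds
  -- the throughput from below.
  have hlim : Tendsto (fun x => (b⁻¹ + (1 + B) / (k x : ℝ))⁻¹) atTop (𝓝 b) := by
    have : Tendsto (fun x => b⁻¹ + (1 + B) / (k x : ℝ)) atTop (𝓝 (b⁻¹ + 0)) :=
      tendsto_const_nhds.add (hk.const_div_atTop _)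
    simpa using this.inv₀ (by simpa using hb0.ne')
  filter_upwards [hlim.eventually_const_lt hcb, hnk δ hδ, hk.eventually_ge_atTop 1,
    eventually_ge_atTop 1] with x hx hx1 hkx hx2
  have hk1 : 1 ≤ k x := by exact_mod_cast hkx
  have hM := h p (n x) (k x) hp (hpq x)
  have hpos : 0 < (meanDelayOf p (n x) (k x)).toReal := ENNReal.toReal_pos
      (zero_lt_one.trans_le (one_le_meanDelayOf hp (hn x hx2) hk1)).ne'
      (ne_top_of_le_ne_top ENNReal.ofReal_ne_top hM)
  have hM' : (meanDelayOf p (n x) (k x)).toReal ≤ b⁻¹ * k x + 1 + B := by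
    refine ENNReal.toReal_le_of_le_ofReal (by positivity)
      (hM.trans (ENNReal.ofReal_le_ofReal ?_))
    nlinarith
  refine hx.trans_le ?_
  calc (b⁻¹ + (1 + B) / (k x : ℝ))⁻¹ = k x / (b⁻¹ * k x + 1 + B) := by
        field_simp
        ring
    _ ≤ _ := div_le_div_of_nonneg_left (Nat.cast_nonneg _) hpos hM'

/-! ### Renewal argument on a sample path -/

/-- The elementary renewal theorem, for one sample path. -/
lemma tendsto_ncard_div {a : ℕ → ℕ} (ha : StrictMono a) (ha0 : a 0 = 0) {μ : ℝ} (hμ : μ ≠ 0)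
    (h : Tendsto (fun j : ℕ => (a j : ℝ) / j) atTop (𝓝 μ)) :
    Tendsto (fun t : ℕ => ({j : ℕ | a (j + 1) ≤ t}.ncard : ℝ) / t) atTop (𝓝 μ⁻¹) := by
  set N : ℕ → ℕ := fun t => {j : ℕ | a (j + 1) ≤ t}.ncard with hN
  -- The set is an initial segment, so `N` inverts `a` in the sense that `a (N t) ≤ t < a (N t +
  -- 1)`.
  have hset : ∀ t j, a (j + 1) ≤ t ↔ j < N t := by
    intro t
    have hex : ∃ j, t < a (j + 1) := ⟨t, (Nat.lt_succ_self t).trans_le (ha.id_le (t + 1))⟩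
    have e : {j : ℕ | a (j + 1) ≤ t} = Set.Iio (Nat.find hex) := by
      ext j
      rw [Set.mem_Iio, Nat.lt_find_iff]
      exact ⟨fun hj m hm => not_lt.2 ((ha.monotone (by omega)).trans hj),
        fun hj => not_lt.1 (hj j le_rfl)⟩
    have hc : N t = Nat.find hex := by
      rw [hN]; simp only [e]
      rw [← Finset.coe_Iio, Set.ncard_coe_finset, Nat.card_Iio]
    intro j
    rw [hc]
    exact Set.ext_iff.1 e j
  have hlo : ∀ t, a (N t) ≤ t := by
    intro t
    rcases Nat.eq_zero_or_pos (N t) with h0 | h0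
    · rw [h0, ha0]; exact Nat.zero_le t
    · obtain ⟨m, hm⟩ := Nat.exists_eq_succ_of_ne_zero h0.ne'
      rw [hm]
      exact (hset t m).2 (by omega)
  have hhi : ∀ t, t < a (N t + 1) := fun t => not_le.1 fun h' => lt_irrefl _ ((hset t _).1 h')
  have hNt : Tendsto N atTop atTop := by
    refine tendsto_atTop.2 fun j => ?_
    filter_upwards [eventually_ge_atTop (a (j + 1))] with t ht
    exact ((hset t j).1 ht).le
  have h1 : Tendsto (fun t => (a (N t) : ℝ) / N t) atTop (𝓝 μ) := h.comp hNt
  have h2 : Tendsto (fun t => (a (N t + 1) : ℝ) / N t) atTop (𝓝 μ) := by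
    have e1 : Tendsto (fun j : ℕ => (a (j + 1) : ℝ) / (j + 1 : ℕ)) atTop (𝓝 μ) :=
      h.comp (tendsto_add_atTop_nat 1)
    have e2 : Tendsto (fun j : ℕ => ((j + 1 : ℕ) : ℝ) / j) atTop (𝓝 1) := by
      have : Tendsto (fun j : ℕ => 1 + 1 / (j : ℝ)) atTop (𝓝 (1 + 0)) :=
        tendsto_const_nhds.add tendsto_one_div_atTop_nhds_zero_nat
      rw [add_zero] at this
      refine this.congr' ?_
      filter_upwards [eventually_gt_atTop 0] with j hj
      have : (j : ℝ) ≠ 0 := by positivity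
      push_cast
      field_simp
    have e3 := e1.mul e2
    rw [mul_one] at e3
    have e4 : Tendsto (fun j : ℕ => (a (j + 1) : ℝ) / j) atTop (𝓝 μ) :=
      e3.congr fun j => div_mul_div_cancel₀ (by positivity)
    exact e4.comp hNt
  -- The sandwich also holds when `N t = 0`, where all three quotients are `0`.
  have h3 : Tendsto (fun t : ℕ => (t : ℝ) / N t) atTop (𝓝 μ) := by
    refine tendsto_of_tendsto_of_tendsto_of_le_of_le h1 h2 (fun t => ?_) fun t => ?_
    · exact div_le_div_of_nonneg_right (Nat.cast_le.2 (hlo t)) (Nat.cast_nonneg _)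
    · exact div_le_div_of_nonneg_right (Nat.cast_le.2 (hhi t).le) (Nat.cast_nonneg _)
  simpa only [inv_div] using h3.inv₀ hμ

section

variable {Ω : Type*} {C : ℕ → ℕ → Ω → Bool} {n k : ℕ}

lemma one_le_decodingDelay (hn : 1 ≤ n) (hk : 1 ≤ k) (j : ℕ) (ω : Ω) :
    1 ≤ decodingDelay C n k j ω := by
  rw [Order.one_le_iff_ne_zero]
  intro h
  obtain ⟨m, hm⟩ := ENat.ne_top_iff_exists.1 (completionTime_ne_top_of_decodingDelay_ne_top C n k
    (ω := ω) (j := j) (by simp [h]))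
  rw [decodingDelay_of_completionTime_eq C n k hm.symm] at h
  have := (delayFrom_le_iff C n k m 0 ω).1 (by simp [h]) 0 hn
  simp at this
  omega

/-- On a sample path with finite delays, the throughput is the inverse of the mean delay per
packet. -/
lemma tendsto_packets_div (hn : 1 ≤ n) (hk : 1 ≤ k) {ω : Ω}
    (hfin : ∀ j, decodingDelay C n k j ω ≠ ⊤) {μ : ℝ} (hμ : μ ≠ 0)
    (h : Tendsto (fun m : ℕ => (∑ j ∈ Finset.range m,
      ((decodingDelay C n k j ω : ℕ∞) : ℝ≥0∞).toReal) / m) atTop (𝓝 μ)) :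
    Tendsto (fun t : ℕ => (packets C n k t ω : ℝ) / t) atTop (𝓝 (k / μ)) := by
  choose d hd using fun j => ENat.ne_top_iff_exists.1 (hfin j)
  set a : ℕ → ℕ := fun j => ∑ i ∈ Finset.range j, d i with ha
  have hT : ∀ j, completionTime C n k ω j = a j := by
    intro j
    induction j with
    | zero => simp [ha]
    | succ j ih => simp [completionTime_succ, ih, ← hd, ha, Finset.sum_range_succ]
  have hmono : StrictMono a := strictMono_nat_of_lt_succ fun j => by
    have : 1 ≤ d j := by
      have := one_le_decodingDelay (C := C) hn hk j ω
      rw [← hd] at this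
      exact_mod_cast this
    simp only [ha, Finset.sum_range_succ]
    omega
  have h' : Tendsto (fun j : ℕ => (a j : ℝ) / j) atTop (𝓝 μ) := by
    refine h.congr fun m => ?_
    simp only [← hd, ha]
    simp
  have := (tendsto_ncard_div hmono (by simp [ha]) hμ h').const_mul (k : ℝ)
  rw [← div_eq_mul_inv] at this
  refine this.congr fun t => ?_
  simp only [packets, hT, Nat.cast_le]
  push_cast
  ring

lemma tendsto_packets_div_of_top {ω : Ω} (h : decodingDelay C n k 0 ω = ⊤) :
    Tendsto (fun t : ℕ => (packets C n k t ω : ℝ) / t) atTop (𝓝 0) := by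
  have hT : ∀ j, completionTime C n k ω (j + 1) = ⊤ := fun j =>
    top_le_iff.1 (le_trans (by rw [completionTime_succ, h]; simp)
      (completionTime_monotone C n k ω (show 0 + 1 ≤ j + 1 by omega)))
  simp [packets, hT]

/-! ### Independent, identically distributed delays and the strong law -/

variable [MeasurableSpace Ω] {P : Measure Ω} [IsProbabilityMeasure P] {p : ℕ → ℝ}

lemma ciSup_delayCDF_eq_one (hp : ∀ i, p i ∈ Set.Icc (0 : ℝ) 1) (h : meanDelayOf p n k ≠ ⊤) :
    ⨆ t, delayCDF p n k t = 1 := by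
  have h1 := (summable_of_meanDelayOf_ne_top hp h).tendsto_atTop_zero
  have h2 := (tendsto_delayCDF hp n k).const_sub 1
  linarith [tendsto_nhds_unique h1 h2]

lemma IsErasureSystem.ae_completionTime_ne_top (hp : ∀ i, p i ∈ Set.Icc (0 : ℝ) 1)
    (hC : IsErasureSystem P p C) (h : meanDelayOf p n k ≠ ⊤) (j : ℕ) :
    ∀ᵐ ω ∂P, completionTime C n k ω j ≠ ⊤ := by
  have hm : MeasurableSet {ω | completionTime C n k ω j ≠ ⊤} :=
    hC.measurable_completionTime j (MeasurableSet.of_discrete (s := {⊤}ᶜ))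
  refine (mem_ae_iff_prob_eq_one hm).2 ?_
  have := hC.real_completionTime_ne_top (n := n) (k := k) hp j
  rw [ciSup_delayCDF_eq_one hp h, one_pow] at this
  simpa [measureReal_def, ENNReal.toReal_eq_one_iff] using this

lemma IsErasureSystem.real_inter_decodingDelay_eq_mul (hp : ∀ i, p i ∈ Set.Icc (0 : ℝ) 1)
    (hC : IsErasureSystem P p C) (h : meanDelayOf p n k ≠ ⊤) {j : ℕ} (t : ℕ) {A : Set Ω}
    (hA : ∀ m : ℕ, DeterminedBy C (Finset.range n ×ˢ Finset.Ioc 0 m)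
      (A ∩ {ω | completionTime C n k ω j = m})) :
    P.real (A ∩ {ω | decodingDelay C n k j ω = t}) = P.real A * delayPMF p n k t := by
  rw [hC.real_inter_decodingDelay_eq hp t hA]
  congr 1
  refine measureReal_congr ?_
  filter_upwards [hC.ae_completionTime_ne_top hp h j] with ω hω
  exact propext ⟨fun h => h.1, fun h => ⟨h, hω⟩⟩

lemma IsErasureSystem.real_decodingDelay_eq (hp : ∀ i, p i ∈ Set.Icc (0 : ℝ) 1)
    (hC : IsErasureSystem P p C) (h : meanDelayOf p n k ≠ ⊤) (j t : ℕ) :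
    P.real {ω | decodingDelay C n k j ω = t} = delayPMF p n k t := by
  simpa using hC.real_inter_decodingDelay_eq_mul hp h (j := j) t (A := Set.univ)
    fun m => by simpa using determinedBy_completionTime_eq C n k j m

lemma IsErasureSystem.ae_decodingDelay_ne_top (hp : ∀ i, p i ∈ Set.Icc (0 : ℝ) 1)
    (hC : IsErasureSystem P p C) (h : meanDelayOf p n k ≠ ⊤) (j : ℕ) :
    ∀ᵐ ω ∂P, decodingDelay C n k j ω ≠ ⊤ := by
  simpa only [completionTime_succ_ne_top_iff] using hC.ae_completionTime_ne_top hp h (j + 1)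

lemma IsErasureSystem.map_decodingDelay_singleton_top (hp : ∀ i, p i ∈ Set.Icc (0 : ℝ) 1)
    (hC : IsErasureSystem P p C) (h : meanDelayOf p n k ≠ ⊤) (j : ℕ) :
    P {ω | decodingDelay C n k j ω = ⊤} = 0 := by
  simpa [ae_iff] using hC.ae_decodingDelay_ne_top hp h j

lemma IsErasureSystem.identDistrib_decodingDelay (hp : ∀ i, p i ∈ Set.Icc (0 : ℝ) 1)
    (hC : IsErasureSystem P p C) (h : meanDelayOf p n k ≠ ⊤) (i j : ℕ) :
    IdentDistrib (decodingDelay C n k i) (decodingDelay C n k j) P P := by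
  refine ⟨(hC.measurable_decodingDelay i).aemeasurable, (hC.measurable_decodingDelay j).aemeasurable,
    Measure.ext_of_singleton fun a => ?_⟩
  rw [Measure.map_apply (hC.measurable_decodingDelay i) (measurableSet_singleton a),
    Measure.map_apply (hC.measurable_decodingDelay j) (measurableSet_singleton a)]
  change P {ω | decodingDelay C n k i ω = a} = P {ω | decodingDelay C n k j ω = a}
  induction a using ENat.recTopCoe with
  | top => rw [hC.map_decodingDelay_singleton_top hp h, hC.map_decodingDelay_singleton_top hp h]
  | coe a =>
    rw [← measureReal_eq_measureReal_iff, hC.real_decodingDelay_eq hp h,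
      hC.real_decodingDelay_eq hp h]

/-- Laws on a countable space are determined by singletons, and there the regeneration formula
factorises. Pairwise independence is all that `strong_law_ae_real` requires. -/
lemma IsErasureSystem.indepFun_decodingDelay (hp : ∀ i, p i ∈ Set.Icc (0 : ℝ) 1)
    (hC : IsErasureSystem P p C) (h : meanDelayOf p n k ≠ ⊤) {i j : ℕ} (hij : i < j) :
    IndepFun (decodingDelay C n k i) (decodingDelay C n k j) P := by
  have hi : Measurable (decodingDelay C n k i) := hC.measurable_decodingDelay i
  have hj : Measurable (decodingDelay C n k j) := hC.measurable_decodingDelay j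
  rw [indepFun_iff_map_prod_eq_prod_map_map hi.aemeasurable hj.aemeasurable]
  refine Measure.ext_of_singleton fun ⟨a, b⟩ => ?_
  rw [← Set.singleton_prod_singleton, Measure.prod_prod,
    Measure.map_apply (hi.prodMk hj) ((measurableSet_singleton a).prod (measurableSet_singleton b)),
    Measure.map_apply hi (measurableSet_singleton a),
    Measure.map_apply hj (measurableSet_singleton b)]
  change P ({ω | decodingDelay C n k i ω = a} ∩ {ω | decodingDelay C n k j ω = b}) =
    P {ω | decodingDelay C n k i ω = a} * P {ω | decodingDelay C n k j ω = b}
  induction a using ENat.recTopCoe with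
  | top =>
    have h0 := hC.map_decodingDelay_singleton_top hp h i
    rw [h0, zero_mul, measure_mono_null Set.inter_subset_left h0]
  | coe a =>
    induction b using ENat.recTopCoe with
    | top =>
      have h0 := hC.map_decodingDelay_singleton_top hp h j
      rw [h0, mul_zero, measure_mono_null Set.inter_subset_right h0]
    | coe b =>
      rw [← ENNReal.toReal_eq_toReal_iff' (measure_ne_top _ _)
        (ENNReal.mul_ne_top (measure_ne_top _ _) (measure_ne_top _ _)), ENNReal.toReal_mul]
      change P.real _ = P.real _ * P.real _
      rw [hC.real_inter_decodingDelay_eq_mul hp h b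
        (determinedBy_decodingDelay_eq C n k hij a), hC.real_decodingDelay_eq hp h j b]

/-- Finitely many erasure probabilities below `1` have a common bound `q < 1`, so
`exists_meanDelayOf_le` applies; any `a > 1 / (1 - q)` would serve. -/
lemma meanDelayOf_ne_top (hp : ∀ i, p i ∈ Set.Icc (0 : ℝ) 1) (h : ∀ i < n, p i ≠ 1) :
    meanDelayOf p n k ≠ ⊤ := by
  obtain ⟨q, hq, hpq⟩ : ∃ q ∈ Set.Ico (0 : ℝ) 1, ∀ i < n, p i ≤ q := by
    induction n with
    | zero => exact ⟨0, by simp⟩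
    | succ n ih =>
      obtain ⟨q, hq, hpq⟩ := ih fun i hi => h i (by omega)
      refine ⟨max q (p n), ⟨hq.1.trans (le_max_left _ _),
        max_lt hq.2 (lt_of_le_of_ne (hp n).2 (h n (by omega)))⟩, fun i hi => ?_⟩
      rcases Nat.lt_succ_iff_lt_or_eq.1 hi with hi | rfl
      · exact (hpq i hi).trans (le_max_left _ _)
      · exact le_max_right _ _
  have h1q : 0 < 1 - q := by linarith [hq.2]
  obtain ⟨δ, -, B, -, hb⟩ := exists_meanDelayOf_le (a := 2 / (1 - q)) ⟨hq.1, hq.2.le⟩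
    (by rw [div_mul_cancel₀ _ h1q.ne']; norm_num)
  exact ne_top_of_le_ne_top ENNReal.ofReal_ne_top (hb p n k hp hpq)

/-- The throughput of the erasure system is `k / 𝔼[U]`. -/
theorem IsErasureSystem.isThroughput (hp : ∀ i, p i ∈ Set.Icc (0 : ℝ) 1)
    (hC : IsErasureSystem P p C) (hn : 1 ≤ n) (hk : 1 ≤ k) :
    IsThroughput P C n k (throughput p n k) := by
  by_cases h : meanDelayOf p n k = ⊤
  -- An infinite mean forces a channel that is almost surely always off. The first block then almost
  -- surely never ends, and `throughput` is `0` by division by `(⊤ : ℝ≥0∞).toReal = 0`.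
  · obtain ⟨i, hi, hpi⟩ : ∃ i < n, p i = 1 := by
      by_contra! hne
      exact meanDelayOf_ne_top hp hne h
    have h0 : ∀ t, delayCDF p n k t = 0 := fun t => by
      obtain ⟨k, rfl⟩ := Nat.exists_eq_add_of_le' hk
      refine le_antisymm ?_ (delayCDF_mem_Icc hp n _ t).1
      simpa [hpi, tailProb_one_succ] using delayCDF_le_tailProb hp hi (k + 1) t
    have h1 := hC.real_completionTime_ne_top (n := n) (k := k) hp 1
    simp only [h0, ciSup_const, pow_one] at h1
    have h2 : ∀ᵐ ω ∂P, completionTime C n k ω 1 = ⊤ := by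
      rw [ae_iff]
      simpa [measureReal_def, ENNReal.toReal_eq_zero_iff] using h1
    filter_upwards [h2] with ω hω
    have e : throughput p n k = 0 := by simp [throughput, h]
    rw [e]
    exact tendsto_packets_div_of_top (by simpa [completionTime_succ] using hω)
  · have hmeas : Measurable fun x : ℕ∞ => (x : ℝ≥0∞).toReal := measurable_from_top
    have hmean := hC.meanDelay_zero hp n k
    have hae : AEMeasurable (fun ω => ((decodingDelay C n k 0 ω : ℕ∞) : ℝ≥0∞)) P :=
      ((measurable_from_top (f := fun x : ℕ∞ => (x : ℝ≥0∞))).comp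
        (hC.measurable_decodingDelay 0)).aemeasurable
    have hsl := strong_law_ae_real
      (fun j ω => ((decodingDelay C n k j ω : ℕ∞) : ℝ≥0∞).toReal) (μ := P)
      (integrable_toReal_of_lintegral_ne_top hae (by rw [← meanDelay, hmean]; exact h))
      (fun i j hij => by
        rcases lt_or_gt_of_ne hij with hij | hij
        · exact (hC.indepFun_decodingDelay hp h hij).comp hmeas hmeas
        · exact ((hC.indepFun_decodingDelay hp h hij).comp hmeas hmeas).symm)
      (fun i => (hC.identDistrib_decodingDelay hp h i 0).comp hmeas)
    rw [integral_toReal hae ((hC.ae_decodingDelay_ne_top hp h 0).mono fun ω hω => by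
      simpa [lt_top_iff_ne_top] using hω), ← meanDelay, hmean] at hsl
    have hμ : (meanDelayOf p n k).toReal ≠ 0 := (ENNReal.toReal_pos
      (zero_lt_one.trans_le (one_le_meanDelayOf hp hn hk)).ne' h).ne'
    filter_upwards [hsl, ae_all_iff.2 fun j => hC.ae_decodingDelay_ne_top hp h j] with ω hω hfin
    exact tendsto_packets_div hn hk hfin hμ hω

end

/-! ### Capacity and limits -/

lemma le_iSup_fin (p : ℕ → ℝ) {n i : ℕ} (hi : i < n) : p i ≤ ⨆ i : Fin n, p i :=
  le_ciSup (f := fun i : Fin n => p i) (Set.finite_range _).bddAbove ⟨i, hi⟩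

lemma exists_eq_iSup_fin (p : ℕ → ℝ) {n : ℕ} (hn : 1 ≤ n) : ∃ i < n, p i = ⨆ i : Fin n, p i := by
  have : Nonempty (Fin n) := ⟨⟨0, hn⟩⟩
  obtain ⟨i, hi⟩ := exists_eq_ciSup_of_finite (f := fun i : Fin n => p i)
  exact ⟨i, i.2, hi⟩

/-- The user with the worst channel gives the upper bound. The bound is approached with `n` fixed
and `k → ∞`, since `n * exp (-δ k) → 0`. -/
lemma isLUB_throughput {p : ℕ → ℝ} (hp : ∀ i, p i ∈ Set.Icc (0 : ℝ) 1) {n : ℕ} (hn : 1 ≤ n) :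
    IsLUB {x : ℝ | ∃ k : ℕ, 1 ≤ k ∧ x = throughput p n k} (1 - ⨆ i : Fin n, p i) := by
  obtain ⟨i, hi, hpi⟩ := exists_eq_iSup_fin p hn
  rw [← hpi]
  refine ⟨?_, fun b hb => le_of_forall_lt fun c hc => ?_⟩
  · rintro _ ⟨k, -, rfl⟩
    exact throughput_le hp hi
  · have hk : Tendsto (fun k : ℕ => (k : ℝ)) atTop atTop := tendsto_natCast_atTop_atTop
    have hexp : ∀ δ > 0, ∀ᶠ k : ℕ in atTop, n * Real.exp (-δ * k) ≤ 1 := fun δ hδ => by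
      have h1 : Tendsto (fun k : ℕ => Real.exp (-δ * k)) atTop (𝓝 0) :=
        Real.tendsto_exp_atBot.comp (hk.const_mul_atTop_of_neg (neg_lt_zero.2 hδ))
      have h2 := h1.const_mul (n : ℝ)
      rw [mul_zero] at h2
      exact (h2.eventually_lt_const zero_lt_one).mono fun _ h => h.le
    obtain ⟨k, hk1, hk2⟩ := ((eventually_lt_throughput hp (hp i) (n := fun _ => n) (k := id)
      (fun _ j hj => (le_iSup_fin p hj).trans hpi.ge) (fun _ _ => hn) hk hexp hc).and
      (eventually_ge_atTop 1)).exists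
    exact hk1.trans_le (hb ⟨k, hk2, rfl⟩)

/-- From below, `p₀` serves as the common bound `q`. From above, a user with `p i` close to `p₀`
belongs to the system as soon as `n > i`. -/
lemma tendsto_throughput {p : ℕ → ℝ} (hp : ∀ i, p i ∈ Set.Icc (0 : ℝ) 1) {p₀ : ℝ}
    (hp₀ : IsLUB (Set.range p) p₀) {k : ℕ → ℕ}
    (hk : Tendsto (fun n : ℕ => (k n : ℝ) / Real.log n) atTop atTop) :
    Tendsto (fun n : ℕ => throughput p n (k n)) atTop (𝓝 (1 - p₀)) := by
  have hle : ∀ i, p i ≤ p₀ := fun i => hp₀.1 ⟨i, rfl⟩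
  have hq : p₀ ∈ Set.Icc (0 : ℝ) 1 :=
    ⟨(hp 0).1.trans (hle 0), hp₀.2 (by rintro _ ⟨i, rfl⟩; exact (hp i).2)⟩
  have hlog : Tendsto (fun n : ℕ => Real.log n) atTop atTop :=
    Real.tendsto_log_atTop.comp tendsto_natCast_atTop_atTop
  have hk' : Tendsto (fun n : ℕ => (k n : ℝ)) atTop atTop := by
    refine (hk.atTop_mul_atTop₀ hlog).congr' ?_
    filter_upwards [hlog.eventually_gt_atTop 0] with n hn
    exact div_mul_cancel₀ _ hn.ne'
  have hexp : ∀ δ > 0, ∀ᶠ n : ℕ in atTop, n * Real.exp (-δ * k n) ≤ 1 := fun δ hδ => by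
    filter_upwards [hlog.eventually_gt_atTop 0, hk.eventually_ge_atTop δ⁻¹,
      eventually_gt_atTop 0] with n hn hkn hn0
    have hn0 : (0 : ℝ) < n := Nat.cast_pos.2 hn0
    -- This is where `k = ω(ln n)` enters: eventually `k ≥ ln n / δ`, which beats the factor `n` of
    -- the union bound.
    have h1 : Real.log n ≤ δ * k n := by
      rw [le_div_iff₀ hn, inv_mul_le_iff₀ hδ] at hkn
      exact hkn
    calc n * Real.exp (-δ * k n) = Real.exp (Real.log n + -δ * k n) := by
          rw [Real.exp_add, Real.exp_log hn0]
      _ ≤ 1 := Real.exp_le_one_iff.2 (by linarith)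
  refine tendsto_order.2 ⟨fun c hc => ?_, fun c hc => ?_⟩
  · exact eventually_lt_throughput hp hq (n := id) (fun _ i _ => hle i) (fun _ h => h) hk' hexp hc
  · obtain ⟨_, ⟨i, rfl⟩, hi, -⟩ := hp₀.exists_between (show 1 - c < p₀ by linarith)
    filter_upwards [eventually_gt_atTop i] with n hn
    exact (throughput_le hp hn).trans_lt (by linarith)

lemma isGLB_capacity {p : ℕ → ℝ} {p₀ : ℝ} (hp₀ : IsLUB (Set.range p) p₀) :
    IsGLB {x : ℝ | ∃ n : ℕ, 1 ≤ n ∧ x = 1 - ⨆ i : Fin n, p i} (1 - p₀) := by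
  constructor
  · rintro _ ⟨n, hn, rfl⟩
    obtain ⟨i, -, hpi⟩ := exists_eq_iSup_fin p hn
    rw [← hpi]
    exact sub_le_sub_left (hp₀.1 ⟨i, rfl⟩) 1
  · intro b hb
    have : p₀ ≤ 1 - b := hp₀.2 (by
      rintro _ ⟨i, rfl⟩
      have h1 := hb ⟨i + 1, Nat.succ_pos i, rfl⟩
      have h2 := le_iSup_fin p (Nat.lt_succ_self i)
      rw [Nat.succ_eq_add_one] at h2
      linarith)
    linarith

end RLNC

theorem mainTheorem5 {Ω₁ : Type*} [MeasurableSpace Ω₁] (P₁ : Measure Ω₁) [IsProbabilityMeasure P₁]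
    {Ω₀ : Type*} [MeasurableSpace Ω₀] (P₀ : Measure Ω₀) [IsProbabilityMeasure P₀]
    (p : ℕ → ℝ) (hp : ∀ i, p i ∈ Set.Icc (0 : ℝ) 1)
    (p₀ : ℝ) (hp₀ : IsLUB (Set.range p) p₀)
    (C₁ : ℕ → ℕ → Ω₁ → Bool) (hC₁ : RLNC.IsErasureSystem P₁ p C₁)
    (C₀ : ℕ → ℕ → Ω₀ → Bool) (hC₀ : RLNC.IsErasureSystem P₀ (fun _ => p₀) C₀) :
    -- comparison of the distributions and of the means of the decoding delays
    (∀ n k j t : ℕ,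
      P₀ {ω | RLNC.decodingDelay C₀ n k j ω ≤ (t : ℕ∞)}
        ≤ P₁ {ω | RLNC.decodingDelay C₁ n k j ω ≤ (t : ℕ∞)}) ∧
    (∀ n k j : ℕ, RLNC.meanDelay P₁ C₁ n k j ≤ RLNC.meanDelay P₀ C₀ n k j) ∧
    -- the throughputs of both systems exist
    ∃ η₁ η₀ : ℕ → ℕ → ℝ,
      (∀ n k : ℕ, 1 ≤ n → 1 ≤ k → RLNC.IsThroughput P₁ C₁ n k (η₁ n k)) ∧
      (∀ n k : ℕ, 1 ≤ n → 1 ≤ k → RLNC.IsThroughput P₀ C₀ n k (η₀ n k)) ∧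
      (∀ n k : ℕ, 1 ≤ n → 1 ≤ k →
        η₀ n k ≤ η₁ n k ∧ η₁ n k ≤ 1 - ⨆ i : Fin n, p i) ∧
      -- the capacity of the system with `n` users, and of the whole family of users
      (∀ n : ℕ, 1 ≤ n → IsLUB {x : ℝ | ∃ k : ℕ, 1 ≤ k ∧ x = η₁ n k} (1 - ⨆ i : Fin n, p i)) ∧
      IsGLB {x : ℝ | ∃ n : ℕ, 1 ≤ n ∧ x = 1 - ⨆ i : Fin n, p i} (1 - p₀) ∧
      -- convergence to the capacity when `k = ω(ln n)`
      (∀ k : ℕ → ℕ, Tendsto (fun n : ℕ => (k n : ℝ) / Real.log n) atTop atTop →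
        Tendsto (fun n : ℕ => η₀ n (k n)) atTop (𝓝 (1 - p₀)) ∧
        Tendsto (fun n : ℕ => η₁ n (k n)) atTop (𝓝 (1 - p₀))) := by
  have hle : ∀ i, p i ≤ p₀ := fun i => hp₀.1 ⟨i, rfl⟩
  have hq : ∀ _ : ℕ, p₀ ∈ Set.Icc (0 : ℝ) 1 := fun _ =>
    ⟨(hp 0).1.trans (hle 0), hp₀.2 (by rintro _ ⟨i, rfl⟩; exact (hp i).2)⟩
  have hcmp := hC₁.real_decodingDelay_le_mono hp hq hC₀ hle
  refine ⟨fun n k j t => ?_, fun n k j => ?_, RLNC.throughput p, RLNC.throughput fun _ => p₀,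
    fun n k hn hk => hC₁.isThroughput hp hn hk, fun n k hn hk => hC₀.isThroughput hq hn hk,
    fun n k hn hk => ⟨RLNC.throughput_anti hp hq hle hn hk, ?_⟩,
    fun n hn => RLNC.isLUB_throughput hp hn, RLNC.isGLB_capacity hp₀,
    fun k hk => ⟨RLNC.tendsto_throughput hq (by simp) hk, RLNC.tendsto_throughput hp hp₀ hk⟩⟩
  · exact (ENNReal.toReal_le_toReal (measure_ne_top _ _) (measure_ne_top _ _)).1 (hcmp n k j t)
  · rw [hC₁.meanDelay_eq_tsum_measure, hC₀.meanDelay_eq_tsum_measure]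
    exact ENNReal.tsum_le_tsum fun t => ENNReal.ofReal_le_ofReal (sub_le_sub_left (hcmp n k j t) 1)
  · exact (RLNC.isLUB_throughput hp hn).1 ⟨k, hk, rfl⟩
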